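/- For $z,w\in\mathbb C^d$ put $\langle z,w\rangle=\sum_{j}z_j\overline{w_j}$. Let $\mathcal F^2(\mathbb C^d)$ be the Fock space of all entire functions $f$ on $\mathbb C^d$ with $\|f\|^2=\pi^{-d}\int_{\mathbb C^d}|f(z)|^2e^{-|z|^2}\,dV(z)<\infty$, a Hilbert space with inner product $\langle f,g\rangle=\pi^{-d}\int_{\mathbb C^d} f(z)\overline{g(z)}e^{-|z|^2}\,dV(z)$. For a nonzero entire function $\psi:\mathbb C^d\to\mathbb C$ and a holomorphic map $\varphi:\mathbb C^d\to\mathbb C^d$, the maximal weighted composition operator $C_{\psi,\varphi,\max}$ has the domain $\{f\in\mathcal F^2(\mathbb C^d):\psi\cdot(f\circ\varphi)\in\mathcal F^2(\mathbb C^d)\}$ and acts by $C_{\psi,\varphi,\max}f=\psi\cdot(f\circ\varphi)$. For operators $T,S$ write $T\preceq S$ if $\operatorname{dom}(T)\subseteq\operatorname{dom}(S)$ and $Tf=Sf$ for all $f\in\operatorname{dom}(T)$. **Proposition.** Let $\psi,\xi$ be nonzero entire functions on $\mathbb C^d$ and let $\varphi,\phi$ be holomorphic self-mappings of $\mathbb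 C^d$. Then $C_{\psi,\varphi,\max}$ is densely defined (so that its adjoint exists) and $$C_{\psi,\varphi,\max}^*\preceq C_{\xi,\phi,\max}$$ if and only if there are $\theta\in\mathbb C$, a $d\times d$ complex matrix $Q$ and vectors $p,q\in\mathbb C^d$ such that, for all $z\in\mathbb C^d$, $$\psi(z)=\theta e^{\langle z,p\rangle},\quad \varphi(z)=Qz+q,\quad \xi(z)=\overline{\theta}\,e^{\langle z,q\rangle},\quad \phi(z)=Q^*z+p.$$ If, in addition to these forms, $Q=Q^*$, then $C_{\psi,\varphi,\max}^*=C_{\xi,\phi,\max}$. -/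

import Mathlib

open MeasureTheory

/-- The complex Euclidean space `ℂ^d`. -/
abbrev CSpace (d : ℕ) : Type := EuclideanSpace ℂ (Fin d)

/-- The complex inner product `⟨z, w⟩ = ∑ j, z_j * conj w_j`, linear in the first argument
(Mathlib's `inner ℂ` is linear in the second one). -/
noncomputable def cdot {d : ℕ} (z w : CSpace d) : ℂ := inner ℂ w z

namespace Fock

/-- The space of entire functions `f` on `ℂ^d` with `∫ |f z|^2 e^{-|z|^2} dV(z) < ∞`. -/
def carrier (d : ℕ) : Set (CSpace d → ℂ) :=
  {f | Differentiable ℂ f ∧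
    Integrable (fun z : CSpace d => ‖f z‖ ^ 2 * Real.exp (-‖z‖ ^ 2)) volume}

theorem add_mem {d : ℕ} {f g : CSpace d → ℂ} (hf : f ∈ carrier d) (hg : g ∈ carrier d) :
    f + g ∈ carrier d := by
  refine ⟨hf.1.add hg.1, ?_⟩
  refine Integrable.mono' ((hf.2.const_mul 2).add (hg.2.const_mul 2)) ?_ ?_
  · have h := (hf.1.add hg.1).continuous
    exact Continuous.aestronglyMeasurable (by fun_prop)
  · refine Filter.Eventually.of_forall fun z => ?_
    have hz := Real.exp_pos (-‖z‖ ^ 2)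
    have h1 : ‖f z + g z‖ ≤ ‖f z‖ + ‖g z‖ := norm_add_le _ _
    have h2 : ‖f z + g z‖ ^ 2 ≤ 2 * ‖f z‖ ^ 2 + 2 * ‖g z‖ ^ 2 := by
      nlinarith [norm_nonneg (f z + g z), sq_nonneg (‖f z‖ - ‖g z‖)]
    rw [Real.norm_of_nonneg (by positivity)]
    simp only [Pi.add_apply]
    nlinarith

theorem smul_mem {d : ℕ} (c : ℂ) {f : CSpace d → ℂ} (hf : f ∈ carrier d) :
    c • f ∈ carrier d := by
  refine ⟨hf.1.const_smul c, ?_⟩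
  refine (hf.2.const_mul (‖c‖ ^ 2)).congr (Filter.Eventually.of_forall fun z => ?_)
  simp only [Pi.smul_apply, norm_smul]
  ring

/-- The Fock space as a linear subspace of the space of all functions on `ℂ^d`. -/
def submodule (d : ℕ) : Submodule ℂ (CSpace d → ℂ) where
  carrier := carrier d
  add_mem' := add_mem
  zero_mem' := ⟨differentiable_const 0, by simp⟩
  smul_mem' := smul_mem

end Fock

/-- The Fock space of `ℂ^d`, a type of its own so that it carries the Fock norm and not the
topology of pointwise convergence. -/
def FockSpace (d : ℕ) : Type := Fock.submodule d

namespace FockSpace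

variable {d : ℕ}

noncomputable instance : AddCommGroup (FockSpace d) :=
  inferInstanceAs (AddCommGroup (Fock.submodule d))

noncomputable instance : Module ℂ (FockSpace d) :=
  inferInstanceAs (Module ℂ (Fock.submodule d))

/-- The entire function underlying an element of the Fock space. -/
def toFun (f : FockSpace d) : CSpace d → ℂ := Subtype.val f

instance : CoeFun (FockSpace d) (fun _ => CSpace d → ℂ) := ⟨toFun⟩

/-- An element of the Fock space from a function that belongs to it. -/
def mk (f : CSpace d → ℂ) (hf : f ∈ Fock.submodule d) : FockSpace d := ⟨f, hf⟩

@[simp] theorem mk_apply (f : CSpace d → ℂ) (hf : f ∈ Fock.submodule d) (z : CSpace d) :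
    mk f hf z = f z := rfl

@[ext] theorem ext {f g : FockSpace d} (h : ∀ z, f z = g z) : f = g :=
  Subtype.ext (funext h)

@[simp] theorem add_apply (f g : FockSpace d) (z : CSpace d) : (f + g) z = f z + g z := rfl

@[simp] theorem smul_apply (c : ℂ) (f : FockSpace d) (z : CSpace d) : (c • f) z = c * f z := rfl

@[simp] theorem zero_apply (z : CSpace d) : (0 : FockSpace d) z = 0 := rfl

@[simp] theorem neg_apply (f : FockSpace d) (z : CSpace d) : (-f) z = -f z := rfl

@[simp] theorem sub_apply (f g : FockSpace d) (z : CSpace d) : (f - g) z = f z - g z := rfl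

theorem differentiable (f : FockSpace d) : Differentiable ℂ (f : CSpace d → ℂ) := f.2.1

theorem integrable_sq (f : FockSpace d) :
    Integrable (fun z : CSpace d => ‖f z‖ ^ 2 * Real.exp (-‖z‖ ^ 2)) volume := f.2.2

/-- The inner product `(1 / π^d) ∫ f(z) * conj (g(z)) * e^{-|z|^2} dV(z)`, written with the
argument order of Mathlib: `inner ℂ g f` is this integral. -/
noncomputable instance : Inner ℂ (FockSpace d) :=
  ⟨fun g f => (1 / (Real.pi : ℂ) ^ d) *
    ∫ z : CSpace d, f z * (starRingEnd ℂ) (g z) * (Real.exp (-‖z‖ ^ 2) : ℂ)⟩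

theorem inner_def (g f : FockSpace d) : inner ℂ g f = (1 / (Real.pi : ℂ) ^ d) *
    ∫ z : CSpace d, f z * (starRingEnd ℂ) (g z) * (Real.exp (-‖z‖ ^ 2) : ℂ) := rfl

theorem integrable_mul (f g : FockSpace d) : Integrable
    (fun z : CSpace d => f z * (starRingEnd ℂ) (g z) * (Real.exp (-‖z‖ ^ 2) : ℂ)) volume := by
  refine Integrable.mono' (f.integrable_sq.add g.integrable_sq) ?_ ?_
  · have h1 := f.differentiable.continuous
    have h2 := g.differentiable.continuous
    exact Continuous.aestronglyMeasurable (by fun_prop)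
  · refine Filter.Eventually.of_forall fun z => ?_
    have hz := Real.exp_pos (-‖z‖ ^ 2)
    rw [norm_mul, norm_mul, RCLike.norm_conj, Complex.norm_real, Real.norm_of_nonneg hz.le]
    simp only [Pi.add_apply]
    have : ‖f z‖ * ‖g z‖ ≤ ‖f z‖ ^ 2 + ‖g z‖ ^ 2 := by
      nlinarith [sq_nonneg (‖f z‖ - ‖g z‖), sq_nonneg (‖f z‖), sq_nonneg (‖g z‖)]
    nlinarith

theorem inner_self_eq (f : FockSpace d) : inner ℂ f f =
    (((1 / Real.pi ^ d) * ∫ z : CSpace d, ‖f z‖ ^ 2 * Real.exp (-‖z‖ ^ 2) : ℝ) : ℂ) := by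
  rw [inner_def]
  push_cast
  rw [← integral_complex_ofReal]
  congr 2
  ext z
  rw [Complex.mul_conj, Complex.normSq_eq_norm_sq]
  push_cast
  rfl

theorem eq_zero_of_integral (f : FockSpace d)
    (h : ∫ z : CSpace d, ‖f z‖ ^ 2 * Real.exp (-‖z‖ ^ 2) = 0) : f = 0 := by
  rw [integral_eq_zero_iff_of_nonneg (fun z => by positivity) f.integrable_sq] at h
  have hc := f.differentiable.continuous
  have h2 := (Continuous.ae_eq_iff_eq volume (by fun_prop) continuous_const).1 h
  ext z
  have h3 := congrFun h2 z
  have h4 : ‖f z‖ ^ 2 = 0 := (mul_eq_zero.1 h3).resolve_right (Real.exp_pos _).ne'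
  simpa using h4

noncomputable instance core : InnerProductSpace.Core ℂ (FockSpace d) where
  inner := inner ℂ
  conj_inner_symm f g := by
    rw [inner_def, inner_def, map_mul, ← integral_conj]
    congr 1
    · simp
    · congr 1
      ext z
      simp only [map_mul, Complex.conj_conj, Complex.conj_ofReal]
      ring
  re_inner_nonneg f := by
    rw [inner_self_eq]
    simp only [RCLike.re_to_complex, Complex.ofReal_re]
    exact mul_nonneg (by positivity) (integral_nonneg fun z => by positivity)
  add_left f g h := by
    simp only [inner_def]
    rw [← mul_add, ← integral_add (integrable_mul h f) (integrable_mul h g)]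
    congr 2
    ext z
    simp only [add_apply, map_add]
    ring
  smul_left f g r := by
    simp only [inner_def]
    have h : ∀ z : CSpace d, g z * (starRingEnd ℂ) ((r • f) z) * (Real.exp (-‖z‖ ^ 2) : ℂ) =
        (starRingEnd ℂ) r * (g z * (starRingEnd ℂ) (f z) * (Real.exp (-‖z‖ ^ 2) : ℂ)) := fun z => by
      simp only [smul_apply, map_mul]
      ring
    simp only [h, integral_const_mul]
    ring
  definite f h := by
    rw [inner_self_eq, Complex.ofReal_eq_zero] at h
    refine f.eq_zero_of_integral ?_
    have : (1 / Real.pi ^ d) ≠ 0 := by positivity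
    simpa [this] using h

noncomputable instance : NormedAddCommGroup (FockSpace d) :=
  InnerProductSpace.Core.toNormedAddCommGroup (𝕜 := ℂ)

noncomputable instance : InnerProductSpace ℂ (FockSpace d) :=
  InnerProductSpace.ofCore core.toCore

theorem norm_sq_eq (f : FockSpace d) :
    ‖f‖ ^ 2 = (1 / Real.pi ^ d) * ∫ z : CSpace d, ‖f z‖ ^ 2 * Real.exp (-‖z‖ ^ 2) := by
  rw [← Complex.ofReal_inj, ← inner_self_eq, inner_self_eq_norm_sq_to_K]
  simp


theorem smul_ball_integral {E : Type*} [NormedAddCommGroup E] [NormedSpace ℝ E]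
    (a : ℂ) (ha : ‖a‖ = 1) (g : CSpace d → E) :
    ∫ w in Metric.ball (0 : CSpace d) 1, g (a • w) = ∫ w in Metric.ball (0 : CSpace d) 1, g w := by
  have ha0 : a ≠ 0 := by
    rintro rfl
    simp at ha
  let L : CSpace d ≃ₗᵢ[ℝ] CSpace d :=
    { toLinearEquiv := (LinearEquiv.smulOfNeZero ℂ (CSpace d) a ha0).restrictScalars ℝ
      norm_map' := fun w => by simp [norm_smul, ha] }
  have hL : ∀ w, L w = a • w := fun w => rfl
  have h := L.measurePreserving.setIntegral_preimage_emb
    L.toHomeomorph.measurableEmbedding g (Metric.ball 0 1)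
  have hp : L ⁻¹' (Metric.ball (0 : CSpace d) 1) = Metric.ball 0 1 := by
    ext w
    simp
  rw [hp] at h
  simpa only [hL] using h

theorem mean_value {g : CSpace d → ℂ} (hg : Differentiable ℂ g) (z : CSpace d) :
    (volume.real (Metric.ball (0 : CSpace d) 1) : ℂ) * g z
      = ∫ w in Metric.ball (0 : CSpace d) 1, g (z + w) := by
  have hc := hg.continuous
  have h1 : ∀ w : CSpace d, ∫ t in (0 : ℝ)..2 * Real.pi, g (z + circleMap 0 1 t • w)
      = (2 * Real.pi : ℝ) • g z := by
    intro w
    have hd : Differentiable ℂ (fun c : ℂ => g (z + c • w)) := by fun_prop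
    have h := (hd.diffContOnCl (s := Metric.ball (0 : ℂ) |1|)).circleAverage
    rw [Real.circleAverage_def] at h
    simp only [zero_smul, add_zero] at h
    rw [← h, smul_smul, mul_inv_cancel₀ (by positivity), one_smul]
  have h2 : ∫ w in Metric.ball (0 : CSpace d) 1, ∫ t in (0 : ℝ)..2 * Real.pi,
      g (z + circleMap 0 1 t • w) = ∫ t in (0 : ℝ)..2 * Real.pi,
        ∫ w in Metric.ball (0 : CSpace d) 1, g (z + circleMap 0 1 t • w) := by
    simp only [intervalIntegral.integral_of_le Real.two_pi_pos.le]
    refine integral_integral_swap ?_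
    rw [Measure.prod_restrict]
    have hK : IsCompact (Metric.closedBall (0 : CSpace d) 1 ×ˢ Set.Icc (0 : ℝ) (2 * Real.pi)) :=
      (isCompact_closedBall _ _).prod isCompact_Icc
    refine IntegrableOn.mono_set (ContinuousOn.integrableOn_compact hK ?_)
      (Set.prod_mono Metric.ball_subset_closedBall Set.Ioc_subset_Icc_self)
    refine Continuous.continuousOn ?_
    have := continuous_circleMap 0 1
    simp only [Function.uncurry_def]
    fun_prop
  have h3 : ∀ t : ℝ, ∫ w in Metric.ball (0 : CSpace d) 1, g (z + circleMap 0 1 t • w)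
      = ∫ w in Metric.ball (0 : CSpace d) 1, g (z + w) := fun t =>
    smul_ball_integral (circleMap 0 1 t) (by simp) (fun w => g (z + w))
  simp only [h1, h3, intervalIntegral.integral_const, setIntegral_const, sub_zero] at h2
  rw [smul_comm] at h2
  have h4 := smul_right_injective ℂ (Real.two_pi_pos.ne') h2
  rw [← h4, Complex.real_smul]

theorem norm_sq_le (f : FockSpace d) {z : CSpace d} {R : ℝ} (hz : ‖z‖ ≤ R) :
    ‖f z‖ ^ 2 ≤ (Real.exp ((R + 1) ^ 2) * Real.pi ^ d /
      volume.real (Metric.ball (0 : CSpace d) 1)) * ‖f‖ ^ 2 := by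
  have hV : 0 < volume.real (Metric.ball (0 : CSpace d) 1) :=
    ENNReal.toReal_pos (Metric.measure_ball_pos _ _ one_pos).ne' measure_ball_lt_top.ne
  have hf := f.differentiable
  have hc := hf.continuous
  have h1 := mean_value (hf.pow 2) z
  have hi : Integrable (fun w : CSpace d => ‖f (z + w)‖ ^ 2 * Real.exp (-‖z + w‖ ^ 2)) :=
    f.integrable_sq.comp_add_left z
  have h2 : volume.real (Metric.ball (0 : CSpace d) 1) * ‖f z‖ ^ 2 ≤
      Real.exp ((R + 1) ^ 2) * ∫ w : CSpace d, ‖f w‖ ^ 2 * Real.exp (-‖w‖ ^ 2) := by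
    calc volume.real (Metric.ball (0 : CSpace d) 1) * ‖f z‖ ^ 2
        = ‖(volume.real (Metric.ball (0 : CSpace d) 1) : ℂ) * (f z) ^ 2‖ := by
          rw [norm_mul, Complex.norm_real, Real.norm_of_nonneg hV.le, norm_pow]
      _ = ‖∫ w in Metric.ball (0 : CSpace d) 1, (f (z + w)) ^ 2‖ := by
          rw [← Pi.pow_apply (f : CSpace d → ℂ) 2 z, h1]
          rfl
      _ ≤ ∫ w in Metric.ball (0 : CSpace d) 1,
            Real.exp ((R + 1) ^ 2) * (‖f (z + w)‖ ^ 2 * Real.exp (-‖z + w‖ ^ 2)) := by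
          refine norm_integral_le_of_norm_le (hi.integrableOn.const_mul _) ?_
          refine (ae_restrict_mem measurableSet_ball).mono fun w hw => ?_
          have hw1 : ‖w‖ ≤ 1 := by simpa using (le_of_lt hw : dist w 0 ≤ 1)
          have h3 : ‖z + w‖ ≤ R + 1 := (norm_add_le _ _).trans (by linarith)
          have h4 : 1 ≤ Real.exp ((R + 1) ^ 2) * Real.exp (-‖z + w‖ ^ 2) := by
            rw [← Real.exp_add, Real.one_le_exp_iff]
            nlinarith [norm_nonneg (z + w)]
          rw [norm_pow]
          nlinarith [sq_nonneg ‖f (z + w)‖]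
      _ ≤ ∫ w : CSpace d,
            Real.exp ((R + 1) ^ 2) * (‖f (z + w)‖ ^ 2 * Real.exp (-‖z + w‖ ^ 2)) := by
          refine setIntegral_le_integral (hi.const_mul _) (Filter.Eventually.of_forall fun w => ?_)
          simp only [Pi.zero_apply]
          positivity
      _ = Real.exp ((R + 1) ^ 2) * ∫ w : CSpace d, ‖f w‖ ^ 2 * Real.exp (-‖w‖ ^ 2) := by
          rw [integral_const_mul, integral_add_left_eq_self
            (fun w : CSpace d => ‖f w‖ ^ 2 * Real.exp (-‖w‖ ^ 2)) z]
  rw [norm_sq_eq, div_mul_eq_mul_div, le_div_iff₀ hV, mul_comm (‖f z‖ ^ 2)]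
  refine h2.trans (le_of_eq ?_)
  have : Real.pi ^ d ≠ 0 := by positivity
  field_simp

/-- Point evaluations are bounded, uniformly on balls. -/
theorem exists_norm_le (d : ℕ) (R : ℝ) :
    ∃ C : ℝ, ∀ (f : FockSpace d) (z : CSpace d), ‖z‖ ≤ R → ‖f z‖ ≤ C * ‖f‖ := by
  refine ⟨√(Real.exp ((R + 1) ^ 2) * Real.pi ^ d /
      volume.real (Metric.ball (0 : CSpace d) 1)), fun f z hz => ?_⟩
  refine abs_le_of_sq_le_sq' ?_ (by positivity) |>.2
  rw [mul_pow, Real.sq_sqrt (by positivity)]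
  exact norm_sq_le f hz

theorem exists_norm_fderiv_le (d : ℕ) (R : ℝ) :
    ∃ C : ℝ, ∀ (f : FockSpace d) (z : CSpace d), ‖z‖ ≤ R →
      ‖fderiv ℂ (f : CSpace d → ℂ) z‖ ≤ C * ‖f‖ := by
  obtain ⟨C, hC⟩ := exists_norm_le d (R + 1)
  refine ⟨C, fun f z hz => ?_⟩
  have hf := f.differentiable
  have h0 : 0 ≤ C * ‖f‖ := (norm_nonneg _).trans (hC f z (by linarith))
  refine ContinuousLinearMap.opNorm_le_of_unit_norm h0 fun v hv => ?_
  have hd : Differentiable ℂ (fun t : ℂ => (f : CSpace d → ℂ) (z + t • v)) := by fun_prop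
  have h1 : HasDerivAt (fun t : ℂ => (f : CSpace d → ℂ) (z + t • v))
      (fderiv ℂ (f : CSpace d → ℂ) z v) 0 := by
    have ha : HasDerivAt (fun t : ℂ => z + t • v) v 0 := by
      simpa using ((hasDerivAt_id (0 : ℂ)).smul_const v).const_add z
    have hb : HasFDerivAt (f : CSpace d → ℂ) (fderiv ℂ (f : CSpace d → ℂ) z)
        (z + (0 : ℂ) • v) := by
      simpa using (hf z).hasFDerivAt
    exact hb.comp_hasDerivAt 0 ha
  rw [← h1.deriv, ← div_one (C * ‖f‖)]
  refine Complex.norm_deriv_le_of_forall_mem_sphere_norm_le one_pos hd.diffContOnCl fun t ht => ?_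
  refine hC f _ ((norm_add_le _ _).trans ?_)
  have ht1 : ‖t‖ = 1 := by simpa using ht
  rw [norm_smul, ht1, hv]
  linarith

/-- The isometric embedding into `L^2` of Lebesgue measure. -/
noncomputable def toL2 (f : FockSpace d) : CSpace d → ℂ :=
  fun z => f z * ((Real.exp (-‖z‖ ^ 2 / 2) : ℝ) : ℂ)

theorem norm_toL2_sq (f : FockSpace d) (z : CSpace d) :
    ‖toL2 f z‖ ^ 2 = ‖f z‖ ^ 2 * Real.exp (-‖z‖ ^ 2) := by
  rw [toL2, norm_mul, Complex.norm_real, Real.norm_of_nonneg (Real.exp_pos _).le, mul_pow,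
    ← Real.exp_nat_mul]
  congr 2
  push_cast
  ring

theorem memLp_toL2 (f : FockSpace d) : MemLp (toL2 f) 2 volume := by
  have hc := f.differentiable.continuous
  have hm : AEStronglyMeasurable (toL2 f) volume := by
    unfold toL2
    exact Continuous.aestronglyMeasurable (by fun_prop)
  rw [memLp_two_iff_integrable_sq_norm hm]
  simpa only [norm_toL2_sq] using f.integrable_sq

/-- The class of `toL2 f` in `L^2`. -/
noncomputable def toLp (f : FockSpace d) : Lp ℂ 2 (volume : Measure (CSpace d)) :=
  (memLp_toL2 f).toLp (toL2 f)

theorem coeFn_toLp (f : FockSpace d) : toLp f =ᵐ[volume] toL2 f := (memLp_toL2 f).coeFn_toLp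

theorem toLp_add (f g : FockSpace d) : toLp (f + g) = toLp f + toLp g := by
  rw [toLp, toLp, toLp, ← MemLp.toLp_add]
  refine MemLp.toLp_congr _ _ (Filter.Eventually.of_forall fun z => ?_)
  simp [toL2, add_mul]

theorem norm_toLp_sq (f : FockSpace d) : ‖toLp f‖ ^ 2 = Real.pi ^ d * ‖f‖ ^ 2 := by
  have h : ((‖toLp f‖ ^ 2 : ℝ) : ℂ) = ∫ z : CSpace d, ((‖toL2 f z‖ ^ 2 : ℝ) : ℂ) := by
    push_cast
    rw [← Complex.coe_algebraMap, ← inner_self_eq_norm_sq_to_K (𝕜 := ℂ), L2.inner_def]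
    refine integral_congr_ae ((coeFn_toLp f).mono fun z hz => ?_)
    simp only [hz, inner_self_eq_norm_sq_to_K]
  rw [integral_complex_ofReal, Complex.ofReal_inj] at h
  rw [h, norm_sq_eq]
  simp only [norm_toL2_sq]
  have : Real.pi ^ d ≠ 0 := by positivity
  field_simp

theorem norm_toLp (f : FockSpace d) : ‖toLp f‖ = √(Real.pi ^ d) * ‖f‖ := by
  rw [← Real.sqrt_sq (norm_nonneg (toLp f)), norm_toLp_sq, Real.sqrt_mul (by positivity),
    Real.sqrt_sq (norm_nonneg f)]

theorem toLp_sub (f g : FockSpace d) : toLp (f - g) = toLp f - toLp g := by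
  rw [eq_sub_iff_add_eq, ← toLp_add, sub_add_cancel]

theorem toLp_sum (u : ℕ → FockSpace d) (n : ℕ) :
    toLp (∑ i ∈ Finset.range n, u i) = ∑ i ∈ Finset.range n, toLp (u i) := by
  induction n with
  | zero =>
    have h := toLp_sub (0 : FockSpace d) 0
    simpa using h
  | succ n ih => rw [Finset.sum_range_succ, Finset.sum_range_succ, toLp_add, ih]

theorem sum_apply (u : ℕ → FockSpace d) (n : ℕ) (z : CSpace d) :
    (∑ i ∈ Finset.range n, u i) z = ∑ i ∈ Finset.range n, u i z := by
  induction n with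
  | zero => simp
  | succ n ih => rw [Finset.sum_range_succ, Finset.sum_range_succ, add_apply, ih]

theorem summable_apply {u : ℕ → FockSpace d} (hu : Summable fun n => ‖u n‖) (z : CSpace d) :
    Summable fun n => u n z := by
  obtain ⟨C, hC⟩ := exists_norm_le d ‖z‖
  exact Summable.of_norm_bounded (hu.mul_left C) fun n => hC (u n) z le_rfl

theorem differentiable_tsum {u : ℕ → FockSpace d} (hu : Summable fun n => ‖u n‖) :
    Differentiable ℂ fun z : CSpace d => ∑' n, u n z := by
  intro z
  obtain ⟨C, hC⟩ := exists_norm_fderiv_le d (‖z‖ + 1)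
  have hz : z ∈ Metric.ball (0 : CSpace d) (‖z‖ + 1) := by simp
  have h := hasFDerivAt_tsum_of_isPreconnected (𝕜 := ℂ) (hu.mul_left C)
    (f := fun n => (u n : CSpace d → ℂ)) (f' := fun n => fderiv ℂ (u n : CSpace d → ℂ))
    (s := Metric.ball (0 : CSpace d) (‖z‖ + 1)) Metric.isOpen_ball
    (convex_ball (0 : CSpace d) (‖z‖ + 1)).isPreconnected
    (fun n x _ => ((u n).differentiable x).hasFDerivAt)
    (fun n x hx => hC (u n) x (by simpa using (le_of_lt hx : dist x 0 ≤ ‖z‖ + 1)))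
    hz (summable_apply hu z) hz
  exact h.differentiableAt

/-- The Fock space is a Hilbert space. -/
instance : CompleteSpace (FockSpace d) := by
  refine NormedAddCommGroup.completeSpace_of_summable_imp_tendsto fun u hu => ?_
  have hU : Summable fun n => ‖toLp (u n)‖ := by
    simp only [norm_toLp]
    exact hu.mul_left _
  have hG := hU.of_norm.hasSum.tendsto_sum_nat
  set G := ∑' n, toLp (u n) with hGdef
  simp only [← toLp_sum] at hG
  obtain ⟨ns, hns, hae⟩ := (tendstoInMeasure_of_tendsto_Lp hG).exists_seq_tendsto_ae
  have hcoe : ∀ᵐ z : CSpace d, ∀ n,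
      toLp (∑ i ∈ Finset.range n, u i) z = toL2 (∑ i ∈ Finset.range n, u i) z :=
    ae_all_iff.2 fun n => coeFn_toLp _
  have hGf : ∀ᵐ z : CSpace d,
      G z = (∑' n, u n z) * ((Real.exp (-‖z‖ ^ 2 / 2) : ℝ) : ℂ) := by
    filter_upwards [hae, hcoe] with z h1 h2
    refine tendsto_nhds_unique h1 ?_
    simp only [h2, toL2, sum_apply]
    exact (((summable_apply hu z).hasSum.tendsto_sum_nat).comp hns.tendsto_atTop).mul_const _
  have hmem : (fun z : CSpace d => ∑' n, u n z) ∈ Fock.submodule d := by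
    refine ⟨differentiable_tsum hu, ?_⟩
    refine ((memLp_two_iff_integrable_sq_norm (Lp.aestronglyMeasurable G)).1 (Lp.memLp G)).congr ?_
    filter_upwards [hGf] with z hz
    rw [hz, norm_mul, Complex.norm_real, Real.norm_of_nonneg (Real.exp_pos _).le, mul_pow,
      ← Real.exp_nat_mul]
    congr 2
    push_cast
    ring
  refine ⟨mk _ hmem, ?_⟩
  have hGeq : toLp (mk _ hmem) = G := by
    refine Lp.ext ?_
    filter_upwards [hGf, coeFn_toLp (mk _ hmem)] with z h1 h2
    rw [h1, h2]
    rfl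
  rw [tendsto_iff_norm_sub_tendsto_zero] at hG ⊢
  rw [← hGeq] at hG
  simp only [← toLp_sub, norm_toLp] at hG
  have h := hG.const_mul (√(Real.pi ^ d))⁻¹
  have hpi : √(Real.pi ^ d) ≠ 0 := by positivity
  simpa [← mul_assoc, inv_mul_cancel₀ hpi] using h

end FockSpace

/-- The weighted composition expression `E_{ψ,φ}(f) = ψ · (f ∘ φ)`. -/
def weightedComp {d : ℕ} (ψ : CSpace d → ℂ) (φ : CSpace d → CSpace d) (f : CSpace d → ℂ) :
    CSpace d → ℂ :=
  fun z => ψ z * f (φ z)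

/-- The maximal weighted composition operator on the Fock space: its domain consists of all `f` in
the Fock space for which `ψ · (f ∘ φ)` is in the Fock space. -/
noncomputable def maxWeightedComp {d : ℕ} (ψ : CSpace d → ℂ) (φ : CSpace d → CSpace d) :
    FockSpace d →ₗ.[ℂ] FockSpace d where
  domain :=
    { carrier := {f | weightedComp ψ φ f ∈ Fock.submodule d}
      add_mem' := fun {f g} hf hg => by
        have h := (Fock.submodule d).add_mem hf hg
        have e : weightedComp ψ φ (f + g : FockSpace d) =
            weightedComp ψ φ f + weightedComp ψ φ g := by
          funext z
          simp [weightedComp, mul_add]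
        rw [← e] at h
        exact h
      zero_mem' := by
        have h := (Fock.submodule d).zero_mem
        have e : weightedComp ψ φ (0 : FockSpace d) = 0 := by
          funext z
          simp [weightedComp]
        rw [← e] at h
        exact h
      smul_mem' := fun c f hf => by
        have h := (Fock.submodule d).smul_mem c hf
        have e : weightedComp ψ φ (c • f : FockSpace d) = c • weightedComp ψ φ f := by
          funext z
          simp [weightedComp, mul_left_comm]
        rw [← e] at h
        exact h }
  toFun :=
    { toFun := fun f => FockSpace.mk (weightedComp ψ φ (f : FockSpace d)) f.2
      map_add' := fun f g => by
        ext z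
        simp [weightedComp, mul_add]
      map_smul' := fun c f => by
        ext z
        simp [weightedComp, mul_left_comm] }

/-- The affine map `z ↦ Q z + q` of `ℂ^d`. -/
noncomputable def affineMap {d : ℕ} (Q : Matrix (Fin d) (Fin d) ℂ) (q : CSpace d) :
    CSpace d → CSpace d :=
  fun z => Matrix.toEuclideanLin Q z + q

/-- The function `z ↦ θ e^{⟨z, p⟩}` on `ℂ^d`. -/
noncomputable def expWeight {d : ℕ} (θ : ℂ) (p : CSpace d) : CSpace d → ℂ :=
  fun z => θ * Complex.exp (cdot z p)

/-! Everything rests on the kernels $K_w(z)=e^{\langle z,w\rangle}$, which reproduce point values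
and span a dense subspace.

Necessity: pairing with $K_z$ evaluates at $z$, so the adjoint sends $K_z$ to
$\overline{\psi(z)}K_{\varphi(z)}$. Evaluating the inclusion on $K_z$ at $u$ gives
$\xi(u)e^{\langle\phi(u),z\rangle}=\overline{\psi(z)}e^{\langle u,\varphi(z)\rangle}$
(`kernel_identity_of_adjoint_le`). The cases $u=0$ and $z=0$ make $\psi$ and $\xi$ exponential. What
remains says that $\langle\phi(u)-\phi(0),z\rangle-\langle u,\varphi(z)-\varphi(0)\rangle$ has
exponential 1; it is entire in $u$ and vanishes at $u=0$, hence everywhere. Two maps adjoint to each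
other in this sense are linear.

Sufficiency: for exponential weights and affine symbols the operator maps kernels to multiples of
kernels. Its domain is therefore dense, and pairing with kernels computes the adjoint pointwise
(`adjoint_apply_expWeight_affineMap`).

Equality requires the two maximal operators to be formal adjoints (`inner_weightedComp`), although
kernel spans need not approximate in graph norm. If the linear part is a strict contraction, the
operator is bounded and the formula is immediate. In general, both sides are regularized by
dilations with a complex parameter $r$. For small $r$ this replaces $Q$ by the contraction $rQ$;
both sides are holomorphic on the unit disc, so they agree on all of it, and real $r\to1$ removes
the dilations in the weak limit. -/

/-! ### The sesquilinear pairing -/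

theorem cdot_add_left {d : ℕ} (x y z : CSpace d) : cdot (x + y) z = cdot x z + cdot y z :=
  inner_add_right _ _ _

theorem cdot_add_right {d : ℕ} (x y z : CSpace d) : cdot x (y + z) = cdot x y + cdot x z :=
  inner_add_left _ _ _

theorem cdot_smul_left {d : ℕ} (c : ℂ) (x y : CSpace d) : cdot (c • x) y = c * cdot x y :=
  inner_smul_right _ _ _

theorem cdot_smul_right {d : ℕ} (c : ℂ) (x y : CSpace d) :
    cdot x (c • y) = starRingEnd ℂ c * cdot x y :=
  inner_smul_left _ _ _

@[simp] theorem cdot_zero_left {d : ℕ} (x : CSpace d) : cdot 0 x = 0 := inner_zero_right _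

@[simp] theorem cdot_zero_right {d : ℕ} (x : CSpace d) : cdot x 0 = 0 := inner_zero_left _

theorem conj_cdot {d : ℕ} (x y : CSpace d) : starRingEnd ℂ (cdot x y) = cdot y x :=
  inner_conj_symm _ _

theorem norm_cdot_le {d : ℕ} (x y : CSpace d) : ‖cdot x y‖ ≤ ‖x‖ * ‖y‖ :=
  (norm_inner_le_norm _ _).trans_eq (mul_comm _ _)

theorem cdot_self {d : ℕ} (x : CSpace d) : cdot x x = ((‖x‖ ^ 2 : ℝ) : ℂ) := by
  rw [cdot, inner_self_eq_norm_sq_to_K]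
  simp

@[fun_prop]
theorem differentiable_cdot {d : ℕ} (w : CSpace d) : Differentiable ℂ fun z => cdot z w :=
  (innerSL ℂ w).differentiable

@[fun_prop]
theorem continuous_cdot {d : ℕ} (w : CSpace d) : Continuous fun z => cdot z w :=
  (differentiable_cdot w).continuous

theorem norm_cexp_le {z : ℂ} {a : ℝ} (h : ‖z‖ ≤ a) : ‖Complex.exp z‖ ≤ Real.exp a := by
  rw [Complex.norm_exp]
  exact Real.exp_le_exp.2 ((Complex.re_le_norm z).trans h)

/-! ### Gaussian integrals and reproducing kernels -/

namespace FockSpace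

variable {d : ℕ}

theorem integral_exp_neg_norm_sq (d : ℕ) :
    ∫ z : CSpace d, Real.exp (-‖z‖ ^ 2) = Real.pi ^ d := by
  have h := GaussianFourier.integral_rexp_neg_mul_sq_norm (V := CSpace d) one_pos
  have hf : Module.finrank ℝ (CSpace d) = 2 * d := by
    rw [← Module.finrank_mul_finrank ℝ ℂ (CSpace d)]
    simp
  rw [hf] at h
  simpa using h

theorem integrable_exp_neg_norm_sq (d : ℕ) :
    Integrable fun z : CSpace d => Real.exp (-‖z‖ ^ 2) := by
  -- A nonintegrable function has integral 0 by convention, so the nonzero value $\pi^d$ proves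
  -- integrability.
  refine Integrable.of_integral_ne_zero ?_
  rw [integral_exp_neg_norm_sq]
  positivity

/-- Completing the square: half of the quadratic decay absorbs the linear term at the cost of the
constant $e^{a^2/(2b)}$. This is the dominating function of all later estimates. -/
theorem integrable_exp_linear_sub_sq (d : ℕ) (a : ℝ) {b : ℝ} (hb : 0 < b) :
    Integrable fun z : CSpace d => Real.exp (a * ‖z‖ - b * ‖z‖ ^ 2) := by
  have h := ((integrable_exp_neg_norm_sq d).comp_smul (R := √(b / 2)) (by positivity)).const_mul
    (Real.exp (a ^ 2 / (2 * b)))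
  refine h.mono' (Continuous.aestronglyMeasurable (by fun_prop))
    (Filter.Eventually.of_forall fun z => ?_)
  rw [Real.norm_of_nonneg (Real.exp_pos _).le, ← Real.exp_add, Real.exp_le_exp, norm_smul,
    mul_pow, Real.norm_of_nonneg (by positivity), Real.sq_sqrt (by positivity)]
  have h1 : a ^ 2 / (2 * b) + -(b / 2 * ‖z‖ ^ 2) - (a * ‖z‖ - b * ‖z‖ ^ 2)
      = (a - b * ‖z‖) ^ 2 / (2 * b) := by
    field_simp
    ring
  have h2 : 0 ≤ (a - b * ‖z‖) ^ 2 / (2 * b) := by positivity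
  linarith

theorem kernel_mem (w : CSpace d) :
    (fun z : CSpace d => Complex.exp (cdot z w)) ∈ Fock.submodule d := by
  refine ⟨by fun_prop, ?_⟩
  refine (integrable_exp_linear_sub_sq d (2 * ‖w‖) one_pos).mono'
    (Continuous.aestronglyMeasurable (by fun_prop)) (Filter.Eventually.of_forall fun z => ?_)
  rw [Real.norm_of_nonneg (by positivity)]
  have h := norm_cexp_le (norm_cdot_le z w)
  calc ‖Complex.exp (cdot z w)‖ ^ 2 * Real.exp (-‖z‖ ^ 2)
      ≤ Real.exp (‖z‖ * ‖w‖) ^ 2 * Real.exp (-‖z‖ ^ 2) := by gcongr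
    _ = Real.exp (2 * ‖w‖ * ‖z‖ - 1 * ‖z‖ ^ 2) := by
      rw [← Real.exp_nat_mul, ← Real.exp_add]
      congr 1
      push_cast
      ring

/-- The reproducing kernel `z ↦ e^{⟨z, w⟩}` of the Fock space. -/
noncomputable def kernel (w : CSpace d) : FockSpace d := mk _ (kernel_mem w)

@[simp] theorem kernel_apply (w z : CSpace d) : kernel w z = Complex.exp (cdot z w) := rfl

theorem measurePreserving_smul_of_norm_eq_one (a : ℂ) (ha : ‖a‖ = 1) :
    MeasurePreserving (fun w : CSpace d => a • w) volume volume := by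
  have ha0 : a ≠ 0 := by
    rintro rfl
    simp at ha
  let L : CSpace d ≃ₗᵢ[ℝ] CSpace d :=
    { toLinearEquiv := (LinearEquiv.smulOfNeZero ℂ (CSpace d) a ha0).restrictScalars ℝ
      norm_map' := fun w => by simp [norm_smul, ha] }
  exact L.measurePreserving

theorem measurableEmbedding_smul {a : ℂ} (ha : a ≠ 0) :
    MeasurableEmbedding fun w : CSpace d => a • w :=
  (Homeomorph.smulOfNeZero a ha).measurableEmbedding

/-- The mean value property of entire functions against the Gaussian weight. -/
theorem integral_mul_exp_neg_norm_sq {g : CSpace d → ℂ} (hg : Differentiable ℂ g)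
    (hi : Integrable fun z : CSpace d => g z * (Real.exp (-‖z‖ ^ 2) : ℂ)) :
    ∫ z : CSpace d, g z * (Real.exp (-‖z‖ ^ 2) : ℂ) = (Real.pi : ℂ) ^ d * g 0 := by
  have hc := hg.continuous
  have hcm := continuous_circleMap 0 1
  set G : CSpace d → ℂ := fun z => g z * (Real.exp (-‖z‖ ^ 2) : ℂ) with hG
  have hGc : Continuous G := by fun_prop
  have hn : ∀ t : ℝ, ‖circleMap 0 1 t‖ = 1 := fun t => by simp
  have hn0 : ∀ t : ℝ, circleMap 0 1 t ≠ 0 := fun t => by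
    rw [← norm_ne_zero_iff, hn]
    exact one_ne_zero
  have hrot : ∀ (t : ℝ) (E : Type) [NormedAddCommGroup E] [NormedSpace ℝ E] (F : CSpace d → E),
      ∫ w, F (circleMap 0 1 t • w) = ∫ w, F w := fun t E _ _ F =>
    (measurePreserving_smul_of_norm_eq_one _ (hn t)).integral_comp
      (measurableEmbedding_smul (hn0 t)) F
  -- The weight is constant along the circle through `w`, and the one-variable entire function
  -- $c\mapsto g(cw)$ has circle average $g(0)$.
  have h1 : ∀ w : CSpace d, ∫ t in (0 : ℝ)..2 * Real.pi, G (circleMap 0 1 t • w)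
      = ((2 * Real.pi : ℝ) • g 0) * (Real.exp (-‖w‖ ^ 2) : ℂ) := by
    intro w
    have hd : Differentiable ℂ (fun c : ℂ => g (c • w)) := by fun_prop
    have h := (hd.diffContOnCl (s := Metric.ball (0 : ℂ) |1|)).circleAverage
    rw [Real.circleAverage_def] at h
    simp only [zero_smul] at h
    have h' : ∀ t : ℝ, G (circleMap 0 1 t • w)
        = g (circleMap 0 1 t • w) * (Real.exp (-‖w‖ ^ 2) : ℂ) := fun t => by
      rw [hG]
      simp only [norm_smul, hn, one_mul]
    simp only [h']
    rw [intervalIntegral.integral_mul_const, ← h, smul_smul, mul_inv_cancel₀ (by positivity),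
      one_smul]
  -- Fubini applies because rotations preserve volume: the integral of the norm over `w` does not
  -- depend on `t`.
  have hprod : Integrable (Function.uncurry fun (w : CSpace d) (t : ℝ) => G (circleMap 0 1 t • w))
      (volume.prod (volume.restrict (Set.Ioc 0 (2 * Real.pi)))) := by
    have hm : AEStronglyMeasurable
        (Function.uncurry fun (w : CSpace d) (t : ℝ) => G (circleMap 0 1 t • w))
        (volume.prod (volume.restrict (Set.Ioc 0 (2 * Real.pi)))) := by
      refine Continuous.aestronglyMeasurable ?_
      simp only [Function.uncurry_def]
      fun_prop
    rw [integrable_prod_iff' hm]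
    refine ⟨Filter.Eventually.of_forall fun t => ?_, ?_⟩
    · exact ((measurePreserving_smul_of_norm_eq_one _ (hn t)).integrable_comp_emb
        (measurableEmbedding_smul (hn0 t))).2 hi
    · simp only [Function.uncurry_apply_pair]
      have : ∀ t : ℝ, ∫ w, ‖G (circleMap 0 1 t • w)‖ = ∫ w, ‖G w‖ := fun t =>
        hrot t ℝ fun w => ‖G w‖
      simp only [this]
      exact integrable_const _
  have h2 : ∫ w, ∫ t in (0 : ℝ)..2 * Real.pi, G (circleMap 0 1 t • w)
      = ∫ t in (0 : ℝ)..2 * Real.pi, ∫ w, G (circleMap 0 1 t • w) := by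
    simp only [intervalIntegral.integral_of_le Real.two_pi_pos.le]
    exact integral_integral_swap hprod
  simp only [h1, hrot _ ℂ G] at h2
  rw [intervalIntegral.integral_const, sub_zero, integral_const_mul, smul_mul_assoc] at h2
  have h4 := smul_right_injective ℂ (Real.two_pi_pos.ne') h2
  rw [← h4, integral_complex_ofReal, integral_exp_neg_norm_sq]
  push_cast
  ring

/-- The reproducing property. -/
theorem inner_kernel (f : FockSpace d) (w : CSpace d) : inner ℂ (kernel w) f = f w := by
  rw [inner_def]
  have h0 := integrable_mul f (kernel w)
  have h1 := h0.comp_add_left w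
  rw [← integral_add_left_eq_self _ w]
  -- After translation by `w` the kernel cancels all of the shifted weight but the factor
  -- $e^{-\langle u,w\rangle}$, which is holomorphic in `u` and equals 1 at `u = 0`. The Gaussian
  -- mean value property then returns $f(w)$.
  have he : ∀ u : CSpace d, f (w + u) * starRingEnd ℂ (kernel w (w + u)) *
      (Real.exp (-‖w + u‖ ^ 2) : ℂ)
      = (f (w + u) * Complex.exp (-cdot u w)) * (Real.exp (-‖u‖ ^ 2) : ℂ) := by
    intro u
    have h : ((-‖w + u‖ ^ 2 : ℝ) : ℂ) = -(cdot w w + cdot w u + (cdot u w + cdot u u)) := by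
      rw [← cdot_add_right, ← cdot_add_right, ← cdot_add_left, cdot_self]
      push_cast
      rfl
    have h' : ((-‖u‖ ^ 2 : ℝ) : ℂ) = -cdot u u := by
      rw [cdot_self]
      push_cast
      rfl
    rw [Complex.ofReal_exp, Complex.ofReal_exp, h, h', kernel_apply, ← Complex.exp_conj,
      conj_cdot, cdot_add_right, mul_assoc, mul_assoc, ← Complex.exp_add, ← Complex.exp_add]
    congr 2
    ring
  simp only [he] at h1 ⊢
  have hf := f.differentiable
  rw [integral_mul_exp_neg_norm_sq (g := fun u => f (w + u) * Complex.exp (-cdot u w))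
    (by fun_prop) h1]
  have : (Real.pi : ℂ) ^ d ≠ 0 := pow_ne_zero _ (by exact_mod_cast Real.pi_ne_zero)
  simp only [add_zero, cdot_zero_left, neg_zero, Complex.exp_zero, mul_one]
  field_simp

theorem norm_kernel (w : CSpace d) : ‖kernel w‖ = Real.exp (‖w‖ ^ 2 / 2) := by
  have h := inner_kernel (kernel w) w
  rw [inner_self_eq_norm_sq_to_K, kernel_apply, cdot_self, ← Complex.ofReal_exp] at h
  have h' : ‖kernel w‖ ^ 2 = Real.exp (‖w‖ ^ 2) := by
    rw [← Complex.ofReal_inj]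
    simpa using h
  rw [← Real.sqrt_sq (norm_nonneg (kernel w)), h', Real.exp_half]

/-- Cauchy–Schwarz against the kernel. Squared, this growth just matches the Gaussian weight, so any
strict contraction of the argument leaves decay to spare. -/
theorem norm_apply_le (f : FockSpace d) (w : CSpace d) :
    ‖f w‖ ≤ ‖f‖ * Real.exp (‖w‖ ^ 2 / 2) := by
  rw [← inner_kernel, ← norm_kernel, mul_comm]
  exact norm_inner_le_norm _ _

/-- A function orthogonal to every kernel vanishes at every point. -/
theorem dense_span_kernel (d : ℕ) :
    Dense (Submodule.span ℂ (Set.range (kernel (d := d))) : Set (FockSpace d)) := by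
  rw [Submodule.dense_iff_topologicalClosure_eq_top, Submodule.topologicalClosure_eq_top_iff,
    Submodule.eq_bot_iff]
  intro f hf
  ext w
  rw [← inner_kernel]
  exact hf _ (Submodule.subset_span ⟨w, rfl⟩)

end FockSpace

/-! ### Exponential weights and affine symbols: action on kernels -/

theorem mem_maxWeightedComp_domain {d : ℕ} {ψ : CSpace d → ℂ} {φ : CSpace d → CSpace d}
    {f : FockSpace d} :
    f ∈ (maxWeightedComp ψ φ).domain ↔ weightedComp ψ φ f ∈ Fock.submodule d := Iff.rfl

theorem cdot_toEuclideanLin {d : ℕ} (Q : Matrix (Fin d) (Fin d) ℂ) (z w : CSpace d) :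
    cdot (Matrix.toEuclideanLin Q z) w = cdot z (Matrix.toEuclideanLin Q.conjTranspose w) := by
  rw [cdot, cdot, Matrix.toEuclideanLin_conjTranspose_eq_adjoint, LinearMap.adjoint_inner_left]

@[fun_prop]
theorem differentiable_expWeight {d : ℕ} (θ : ℂ) (p : CSpace d) :
    Differentiable ℂ (expWeight θ p) := by
  unfold expWeight
  fun_prop

@[fun_prop]
theorem differentiable_affineMap {d : ℕ} (Q : Matrix (Fin d) (Fin d) ℂ) (q : CSpace d) :
    Differentiable ℂ (affineMap Q q) :=
  (LinearMap.toContinuousLinearMap (Matrix.toEuclideanLin Q)).differentiable.add_const q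

/-- Regrouping the exponent, $\langle z,p\rangle+\langle Qz+q,w\rangle=\langle q,w\rangle+\langle
z,Q^*w+p\rangle$. The dual data of the adjoint, with `p` and `q` exchanged, originate here. -/
theorem weightedComp_kernel {d : ℕ} (θ : ℂ) (Q : Matrix (Fin d) (Fin d) ℂ) (p q w : CSpace d) :
    weightedComp (expWeight θ p) (affineMap Q q) (FockSpace.kernel w) =
      ((θ * Complex.exp (cdot q w)) • FockSpace.kernel (affineMap Q.conjTranspose p w) :
        FockSpace d) := by
  funext z
  simp only [weightedComp, expWeight, affineMap, FockSpace.smul_apply, FockSpace.kernel_apply,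
    cdot_add_left, cdot_add_right, cdot_toEuclideanLin, Complex.exp_add]
  ring

theorem kernel_mem_domain {d : ℕ} (θ : ℂ) (Q : Matrix (Fin d) (Fin d) ℂ) (p q w : CSpace d) :
    FockSpace.kernel w ∈ (maxWeightedComp (expWeight θ p) (affineMap Q q)).domain := by
  rw [mem_maxWeightedComp_domain, weightedComp_kernel]
  exact Subtype.property _

theorem maxWeightedComp_kernel {d : ℕ} (θ : ℂ) (Q : Matrix (Fin d) (Fin d) ℂ)
    (p q w : CSpace d) :
    maxWeightedComp (expWeight θ p) (affineMap Q q) ⟨_, kernel_mem_domain θ Q p q w⟩ =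
      (θ * Complex.exp (cdot q w)) • FockSpace.kernel (affineMap Q.conjTranspose p w) :=
  Subtype.ext (weightedComp_kernel θ Q p q w)

theorem dense_domain_expWeight_affineMap {d : ℕ} (θ : ℂ) (Q : Matrix (Fin d) (Fin d) ℂ)
    (p q : CSpace d) :
    Dense ((maxWeightedComp (expWeight θ p) (affineMap Q q)).domain : Set (FockSpace d)) := by
  refine (FockSpace.dense_span_kernel d).mono ?_
  refine Submodule.span_le.2 ?_
  rintro _ ⟨w, rfl⟩
  exact kernel_mem_domain θ Q p q w

/-- The value at `w` is the pairing with the kernel at `w`. This kernel lies in the domain, so the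
adjoint can be moved onto it. -/
theorem adjoint_apply_expWeight_affineMap {d : ℕ} (θ : ℂ) (Q : Matrix (Fin d) (Fin d) ℂ)
    (p q : CSpace d)
    (g : (maxWeightedComp (expWeight θ p) (affineMap Q q)).adjoint.domain) :
    ((maxWeightedComp (expWeight θ p) (affineMap Q q)).adjoint g : CSpace d → ℂ) =
      weightedComp (expWeight (starRingEnd ℂ θ) q) (affineMap Q.conjTranspose p)
        (g : FockSpace d) := by
  funext w
  have h := LinearPMap.adjoint_isFormalAdjoint (dense_domain_expWeight_affineMap θ Q p q) g
    ⟨_, kernel_mem_domain θ Q p q w⟩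
  rw [← FockSpace.inner_kernel, ← inner_conj_symm, h, inner_conj_symm, maxWeightedComp_kernel,
    inner_smul_left, FockSpace.inner_kernel, map_mul, ← Complex.exp_conj, conj_cdot]
  rfl

theorem adjoint_expWeight_affineMap_le {d : ℕ} (θ : ℂ) (Q : Matrix (Fin d) (Fin d) ℂ)
    (p q : CSpace d) :
    (maxWeightedComp (expWeight θ p) (affineMap Q q)).adjoint ≤
      maxWeightedComp (expWeight (starRingEnd ℂ θ) q) (affineMap Q.conjTranspose p) := by
  refine ⟨fun g hg => ?_, fun g g' hgg => ?_⟩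
  · rw [mem_maxWeightedComp_domain, ← adjoint_apply_expWeight_affineMap θ Q p q ⟨g, hg⟩]
    exact Subtype.property _
  · refine Subtype.ext ((adjoint_apply_expWeight_affineMap θ Q p q g).trans ?_)
    rw [hgg]
    rfl

/-! ### Strictly contractive linear part -/

/-- A weighted composition operator with exponential weight and affine symbol is bounded when the
linear part of the symbol is a strict contraction. -/
theorem exists_norm_weightedComp_le {d : ℕ} (θ : ℂ) (Q : Matrix (Fin d) (Fin d) ℂ)
    (p q : CSpace d) {c : ℝ} (hc0 : 0 ≤ c) (hc : c < 1)
    (hQ : ∀ z, ‖Matrix.toEuclideanLin Q z‖ ≤ c * ‖z‖) :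
    ∃ C : ℝ, ∀ f : FockSpace d,
      ∃ h : weightedComp (expWeight θ p) (affineMap Q q) f ∈ Fock.submodule d,
        ‖FockSpace.mk _ h‖ ≤ C * ‖f‖ := by
  have hb : 0 < 1 - c ^ 2 := by nlinarith
  have hI := FockSpace.integrable_exp_linear_sub_sq d (2 * ‖p‖ + 2 * c * ‖q‖) hb
  -- By `norm_apply_le`, composition contributes at most $e^{(c\|z\|+\|q\|)^2}$ to the square.
  -- Against the weight $e^{-\|z\|^2}$ the decay $(1-c^2)\|z\|^2$ survives.
  have hpt : ∀ (f : FockSpace d) (z : CSpace d),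
      ‖weightedComp (expWeight θ p) (affineMap Q q) f z‖ ^ 2 * Real.exp (-‖z‖ ^ 2) ≤
        (‖θ‖ ^ 2 * Real.exp (‖q‖ ^ 2) * ‖f‖ ^ 2) *
          Real.exp ((2 * ‖p‖ + 2 * c * ‖q‖) * ‖z‖ - (1 - c ^ 2) * ‖z‖ ^ 2) := by
    intro f z
    have h1 : ‖affineMap Q q z‖ ≤ c * ‖z‖ + ‖q‖ := (norm_add_le _ _).trans (by gcongr; exact hQ z)
    have h2 := FockSpace.norm_apply_le f (affineMap Q q z)
    have h3 := norm_cexp_le (norm_cdot_le z p)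
    calc ‖weightedComp (expWeight θ p) (affineMap Q q) f z‖ ^ 2 * Real.exp (-‖z‖ ^ 2)
        ≤ (‖θ‖ * Real.exp (‖z‖ * ‖p‖) * (‖f‖ * Real.exp ((c * ‖z‖ + ‖q‖) ^ 2 / 2))) ^ 2 *
            Real.exp (-‖z‖ ^ 2) := by
          rw [weightedComp, expWeight, norm_mul, norm_mul]
          gcongr
          refine h2.trans ?_
          gcongr
      _ = ‖θ‖ ^ 2 * ‖f‖ ^ 2 * (Real.exp (‖z‖ * ‖p‖) ^ 2 *
            Real.exp ((c * ‖z‖ + ‖q‖) ^ 2 / 2) ^ 2 * Real.exp (-‖z‖ ^ 2)) := by ring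
      _ = ‖θ‖ ^ 2 * ‖f‖ ^ 2 * (Real.exp (‖q‖ ^ 2) *
            Real.exp ((2 * ‖p‖ + 2 * c * ‖q‖) * ‖z‖ - (1 - c ^ 2) * ‖z‖ ^ 2)) := by
          rw [← Real.exp_nat_mul, ← Real.exp_nat_mul, ← Real.exp_add, ← Real.exp_add,
            ← Real.exp_add]
          congr 2
          push_cast
          ring
      _ = _ := by ring
  have hmem : ∀ f : FockSpace d,
      weightedComp (expWeight θ p) (affineMap Q q) f ∈ Fock.submodule d := by
    intro f
    have hf := f.differentiable
    have hd : Differentiable ℂ (weightedComp (expWeight θ p) (affineMap Q q) f) := by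
      unfold weightedComp
      fun_prop
    have hdc := hd.continuous
    refine ⟨hd, (hI.const_mul (‖θ‖ ^ 2 * Real.exp (‖q‖ ^ 2) * ‖f‖ ^ 2)).mono'
      (Continuous.aestronglyMeasurable (by fun_prop)) (Filter.Eventually.of_forall fun z => ?_)⟩
    rw [Real.norm_of_nonneg (by positivity)]
    exact hpt f z
  set I := ∫ z : CSpace d,
    Real.exp ((2 * ‖p‖ + 2 * c * ‖q‖) * ‖z‖ - (1 - c ^ 2) * ‖z‖ ^ 2)
  have hI0 : 0 ≤ I := integral_nonneg fun z => (Real.exp_pos _).le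
  refine ⟨√(1 / Real.pi ^ d * (‖θ‖ ^ 2 * Real.exp (‖q‖ ^ 2) * I)), fun f => ⟨hmem f, ?_⟩⟩
  refine abs_le_of_sq_le_sq' ?_ (by positivity) |>.2
  rw [mul_pow, Real.sq_sqrt (by positivity), FockSpace.norm_sq_eq]
  calc _ ≤ 1 / Real.pi ^ d * ∫ z : CSpace d, (‖θ‖ ^ 2 * Real.exp (‖q‖ ^ 2) * ‖f‖ ^ 2) *
          Real.exp ((2 * ‖p‖ + 2 * c * ‖q‖) * ‖z‖ - (1 - c ^ 2) * ‖z‖ ^ 2) := by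
        refine mul_le_mul_of_nonneg_left ?_ (by positivity)
        exact integral_mono (FockSpace.integrable_sq _) (hI.const_mul _) (hpt f)
    _ = _ := by
        rw [integral_const_mul]
        ring

/-- The adjoint formula for symbols with strictly contractive linear part. -/
theorem inner_weightedComp_of_contracting {d : ℕ} (θ : ℂ) (Q : Matrix (Fin d) (Fin d) ℂ)
    (p q : CSpace d) {c : ℝ} (hc0 : 0 ≤ c) (hc : c < 1)
    (hQ : ∀ z, ‖Matrix.toEuclideanLin Q z‖ ≤ c * ‖z‖) (f g u v : FockSpace d)
    (hu : (u : CSpace d → ℂ) = weightedComp (expWeight θ p) (affineMap Q q) f)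
    (hv : (v : CSpace d → ℂ) = weightedComp (expWeight (starRingEnd ℂ θ) q)
      (affineMap Q.conjTranspose p) g) :
    inner ℂ g u = inner ℂ v f := by
  obtain ⟨C, hC⟩ := exists_norm_weightedComp_le θ Q p q hc0 hc hQ
  set T := maxWeightedComp (expWeight θ p) (affineMap Q q)
  -- Boundedness of `T` puts every `g` into the domain of the adjoint, whose values are already
  -- known.
  have hg : g ∈ T.adjoint.domain := by
    rw [LinearPMap.mem_adjoint_domain_iff]
    refine AddMonoidHomClass.continuous_of_bound _ (‖g‖ * C) fun x => ?_
    obtain ⟨h, hx⟩ := hC x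
    refine (norm_inner_le_norm g (T x)).trans ?_
    rw [mul_assoc]
    exact mul_le_mul_of_nonneg_left hx (norm_nonneg _)
  have h1 := LinearPMap.adjoint_isFormalAdjoint (dense_domain_expWeight_affineMap θ Q p q)
    ⟨g, hg⟩ ⟨f, (hC f).1⟩
  have h2 : T.adjoint ⟨g, hg⟩ = v :=
    Subtype.ext ((adjoint_apply_expWeight_affineMap θ Q p q ⟨g, hg⟩).trans hv.symm)
  have h3 : T ⟨f, (hC f).1⟩ = u := Subtype.ext hu.symm
  rw [← h2, ← h3]
  exact h1.symm

/-! ### Dilations with a complex parameter -/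

/-- An integral depending holomorphically on a parameter in the unit disc, locally uniformly
dominated, is holomorphic. -/
theorem differentiableOn_integral_unit_ball {d : ℕ} {F : ℂ → CSpace d → ℂ}
    (hc : Continuous (Function.uncurry fun z r => F r z))
    (hd : ∀ z, Differentiable ℂ fun r => F r z)
    (hb : ∀ ρ : ℝ, 0 ≤ ρ → ρ < 1 → ∃ bound : CSpace d → ℝ, Integrable bound ∧
      ∀ r : ℂ, ‖r‖ ≤ ρ → ∀ z, ‖F r z‖ ≤ bound z) :
    DifferentiableOn ℂ (fun r => ∫ z, F r z) (Metric.ball 0 1) := by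
  intro r₀ hr₀
  have hr : ‖r₀‖ < 1 := by simpa using hr₀
  -- Circles of radius `ε` about points of the `ε`-ball at `r₀` stay in the disc of radius
  -- $\|r_0\|+2\varepsilon<1$. Cauchy's estimate there turns the bound on `F` into the bound `bound
  -- z / ε` on its derivative.
  set ε : ℝ := (1 - ‖r₀‖) / 4 with hε
  have hε0 : 0 < ε := by linarith
  obtain ⟨bound, hbi, hbd⟩ := hb (‖r₀‖ + 2 * ε) (by positivity) (by linarith)
  have hcr : ∀ r, Continuous (F r) := fun r => hc.comp (by fun_prop : Continuous fun z => (z, r))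
  have hm := measurable_deriv_with_param hc
  have h := hasDerivAt_integral_of_dominated_loc_of_deriv_le (μ := volume) (F := F)
    (F' := fun r z => deriv (fun s => F s z) r) (x₀ := r₀) (bound := fun z => bound z / ε)
    (Metric.ball_mem_nhds r₀ hε0)
    (Filter.Eventually.of_forall fun r => (hcr r).aestronglyMeasurable)
    (hbi.mono' (hcr r₀).aestronglyMeasurable
      (Filter.Eventually.of_forall fun z => hbd r₀ (by linarith) z))
    (hm.comp (by fun_prop : Measurable fun z : CSpace d => (z, r₀))).aestronglyMeasurable
    (Filter.Eventually.of_forall fun z r hr => ?_) (hbi.div_const ε)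
    (Filter.Eventually.of_forall fun z r _ => (hd z r).hasDerivAt)
  · exact h.2.differentiableAt.differentiableWithinAt
  · refine Complex.norm_deriv_le_of_forall_mem_sphere_norm_le hε0 (hd z).diffContOnCl
      fun s hs => hbd s ?_ z
    have h1 : ‖r - r₀‖ < ε := by simpa [dist_eq_norm] using hr
    have h2 : ‖s - r‖ = ε := by simpa [dist_eq_norm] using hs
    calc ‖s‖ = ‖r₀ + (r - r₀) + (s - r)‖ := by congr 1; ring
      _ ≤ ‖r₀‖ + ‖r - r₀‖ + ‖s - r‖ := norm_add₃_le
      _ ≤ ‖r₀‖ + 2 * ε := by linarith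

/-- The dilation by `r` around `q`, twisted by an exponential weight. -/
noncomputable def dilate {d : ℕ} (p q : CSpace d) (r : ℂ) (h : CSpace d → ℂ) : CSpace d → ℂ :=
  fun z => Complex.exp ((1 - r) * cdot z p) * h (r • z + (1 - r) • q)

/-- For $|r|<1$ the dilation falls under the contractive case, which supplies membership and the
adjoint formula. The conjugate on `r` compensates the antilinearity of the pairing in its second
slot. -/
theorem dilate_eq_weightedComp {d : ℕ} (p q : CSpace d) (r : ℂ) (h : CSpace d → ℂ) :
    dilate p q r h = weightedComp (expWeight 1 ((1 - starRingEnd ℂ r) • p))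
      (affineMap (r • 1) ((1 - r) • q)) h := by
  funext z
  simp [dilate, weightedComp, expWeight, affineMap, cdot_smul_right]

theorem norm_toEuclideanLin_smul_one {d : ℕ} (r : ℂ) (z : CSpace d) :
    ‖Matrix.toEuclideanLin (r • 1 : Matrix (Fin d) (Fin d) ℂ) z‖ ≤ ‖r‖ * ‖z‖ := by
  rw [map_smul, Matrix.toLpLin_one, LinearMap.smul_apply, norm_smul]
  rfl

theorem dilate_mem {d : ℕ} (p q : CSpace d) {r : ℂ} (hr : ‖r‖ < 1) (h : FockSpace d) :
    dilate p q r h ∈ Fock.submodule d := by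
  rw [dilate_eq_weightedComp]
  obtain ⟨C, hC⟩ := exists_norm_weightedComp_le 1 (r • 1) ((1 - starRingEnd ℂ r) • p)
    ((1 - r) • q) (norm_nonneg r) hr (norm_toEuclideanLin_smul_one r)
  exact (hC h).1

/-- For $|r|\le\rho<1$ the dilated factor grows like $e^{\rho^2\|z\|^2/2}$ and `g` like
$e^{\|z\|^2/2}$, up to linear exponents. The weight leaves decay $(1-\rho^2)\|z\|^2/2$, which
dominates uniformly in `r`. -/
theorem differentiableOn_integral_dilate {d : ℕ} (p q : CSpace d) (g h : FockSpace d) :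
    DifferentiableOn ℂ (fun r => ∫ z : CSpace d,
      dilate p q r h z * starRingEnd ℂ (g z) * (Real.exp (-‖z‖ ^ 2) : ℂ)) (Metric.ball 0 1) := by
  have hg := g.differentiable.continuous
  have hh := h.differentiable
  have hhc := hh.continuous
  refine differentiableOn_integral_unit_ball ?_ (fun z => ?_) fun ρ hρ0 hρ => ?_
  · simp only [Function.uncurry_def, dilate]
    have : Continuous fun x : CSpace d × ℂ => cdot x.1 p := (continuous_cdot p).comp continuous_fst
    fun_prop
  · simp only [dilate]
    fun_prop
  · have hb : 0 < (1 - ρ ^ 2) / 2 := by nlinarith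
    refine ⟨_, (FockSpace.integrable_exp_linear_sub_sq d (2 * ‖p‖ + 2 * ρ * ‖q‖) hb).const_mul
      (‖h‖ * ‖g‖ * Real.exp (2 * ‖q‖ ^ 2)), fun r hr z => ?_⟩
    have hr2 : ‖1 - r‖ ≤ 2 := (norm_sub_le _ _).trans (by rw [norm_one]; linarith)
    have h1 : ‖Complex.exp ((1 - r) * cdot z p)‖ ≤ Real.exp (2 * (‖z‖ * ‖p‖)) := by
      refine norm_cexp_le ?_
      rw [norm_mul]
      gcongr
      exact norm_cdot_le z p
    have h2 : ‖h (r • z + (1 - r) • q)‖ ≤ ‖h‖ * Real.exp ((ρ * ‖z‖ + 2 * ‖q‖) ^ 2 / 2) := by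
      refine (h.norm_apply_le _).trans ?_
      gcongr
      refine (norm_add_le _ _).trans ?_
      rw [norm_smul, norm_smul]
      gcongr
    rw [norm_mul, norm_mul, RCLike.norm_conj, Complex.norm_real,
      Real.norm_of_nonneg (Real.exp_pos _).le, dilate, norm_mul]
    calc _ ≤ Real.exp (2 * (‖z‖ * ‖p‖)) * (‖h‖ * Real.exp ((ρ * ‖z‖ + 2 * ‖q‖) ^ 2 / 2)) *
          (‖g‖ * Real.exp (‖z‖ ^ 2 / 2)) * Real.exp (-‖z‖ ^ 2) := by
          gcongr
          exact g.norm_apply_le z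
      _ = ‖h‖ * ‖g‖ * (Real.exp (2 * (‖z‖ * ‖p‖)) * Real.exp ((ρ * ‖z‖ + 2 * ‖q‖) ^ 2 / 2) *
          Real.exp (‖z‖ ^ 2 / 2) * Real.exp (-‖z‖ ^ 2)) := by ring
      _ = ‖h‖ * ‖g‖ * (Real.exp (2 * ‖q‖ ^ 2) *
          Real.exp ((2 * ‖p‖ + 2 * ρ * ‖q‖) * ‖z‖ - (1 - ρ ^ 2) / 2 * ‖z‖ ^ 2)) := by
          simp only [← Real.exp_add]
          congr 2
          ring
      _ = _ := by ring

/-- The contractive bound degenerates as $r\to1$; for real `r` a change of variables gives a uniform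
one instead. The restriction $r\ge1/2$ keeps the Jacobian $r^{-N}$ below $2^N$. -/
theorem exists_norm_dilate_le {d : ℕ} (p q : CSpace d) (h : FockSpace d) :
    ∃ C : ℝ, ∀ r : ℝ, 1 / 2 ≤ r → r < 1 → ∀ hr : dilate p q (r : ℂ) h ∈ Fock.submodule d,
      ‖FockSpace.mk _ hr‖ ≤ C := by
  set N := Module.finrank ℝ (CSpace d)
  set A := Real.exp (‖p‖ ^ 2 + ‖q‖ ^ 2) with hA
  set H : CSpace d → ℝ := fun u => ‖h u‖ ^ 2 * Real.exp (-‖u‖ ^ 2) with hH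
  have hH0 : 0 ≤ ∫ u, H u := integral_nonneg fun u => by positivity
  refine ⟨√(1 / Real.pi ^ d * (A * (2 ^ N * ∫ u, H u))), fun r hr hr1 hmem => ?_⟩
  have hr0 : 0 < r := by linarith
  have hpt : ∀ z : CSpace d, ‖dilate p q (r : ℂ) h z‖ ^ 2 * Real.exp (-‖z‖ ^ 2) ≤
      A * H (r • z + (1 - r) • q) := by
    intro z
    have he : (r : ℂ) • z + (1 - (r : ℂ)) • q = r • z + (1 - r) • q := by
      rw [← Complex.ofReal_one, ← Complex.ofReal_sub, Complex.coe_smul, Complex.coe_smul]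
    have h1 : ‖Complex.exp ((1 - (r : ℂ)) * cdot z p)‖ ≤ Real.exp ((1 - r) * (‖z‖ * ‖p‖)) := by
      refine norm_cexp_le ?_
      rw [norm_mul, ← Complex.ofReal_one, ← Complex.ofReal_sub, Complex.norm_real,
        Real.norm_of_nonneg (by linarith)]
      exact mul_le_mul_of_nonneg_left (norm_cdot_le z p) (by linarith)
    have h2 : ‖r • z + (1 - r) • q‖ ≤ r * ‖z‖ + (1 - r) * ‖q‖ := by
      refine (norm_add_le _ _).trans_eq ?_
      rw [norm_smul, norm_smul, Real.norm_of_nonneg hr0.le, Real.norm_of_nonneg (by linarith)]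
    -- Convexity of the squared norm frees $(1-r)\|z\|^2$, exactly what
    -- $2\|z\|\|p\|\le\|z\|^2+\|p\|^2$, multiplied by $1-r$, consumes.
    have h3 : 2 * ((1 - r) * (‖z‖ * ‖p‖)) + -‖z‖ ^ 2 ≤
        ‖p‖ ^ 2 + ‖q‖ ^ 2 + -‖r • z + (1 - r) • q‖ ^ 2 := by
      have h4 : ‖r • z + (1 - r) • q‖ ^ 2 ≤ r * ‖z‖ ^ 2 + (1 - r) * ‖q‖ ^ 2 := by
        have := pow_le_pow_left₀ (norm_nonneg _) h2 2
        nlinarith [mul_nonneg (mul_nonneg hr0.le (sub_nonneg.2 hr1.le)) (sq_nonneg (‖z‖ - ‖q‖))]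
      nlinarith [mul_nonneg (sub_nonneg.2 hr1.le) (sq_nonneg (‖z‖ - ‖p‖)),
        mul_nonneg hr0.le (sq_nonneg ‖p‖), mul_nonneg hr0.le (sq_nonneg ‖q‖)]
    rw [dilate, he, norm_mul]
    calc _ ≤ (Real.exp ((1 - r) * (‖z‖ * ‖p‖)) * ‖h (r • z + (1 - r) • q)‖) ^ 2 *
          Real.exp (-‖z‖ ^ 2) := by gcongr
      _ = ‖h (r • z + (1 - r) • q)‖ ^ 2 *
          Real.exp (2 * ((1 - r) * (‖z‖ * ‖p‖)) + -‖z‖ ^ 2) := by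
          rw [mul_pow, ← Real.exp_nat_mul, Real.exp_add]
          push_cast
          ring
      _ ≤ ‖h (r • z + (1 - r) • q)‖ ^ 2 *
          Real.exp (‖p‖ ^ 2 + ‖q‖ ^ 2 + -‖r • z + (1 - r) • q‖ ^ 2) := by gcongr
      _ = _ := by
          rw [Real.exp_add, hA, hH]
          ring
  have hi : Integrable fun z : CSpace d => H (r • z + (1 - r) • q) :=
    (h.integrable_sq.comp_add_right ((1 - r) • q)).comp_smul hr0.ne'
  have hint : ∫ z : CSpace d, H (r • z + (1 - r) • q) ≤ 2 ^ N * ∫ u, H u := by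
    rw [Measure.integral_comp_smul volume (fun u => H (u + (1 - r) • q)) r,
      integral_add_right_eq_self H, smul_eq_mul, abs_of_nonneg (by positivity), ← inv_pow]
    gcongr
    rw [inv_le_comm₀ hr0 two_pos]
    linarith
  refine abs_le_of_sq_le_sq' ?_ (by positivity) |>.2
  rw [Real.sq_sqrt (by positivity), FockSpace.norm_sq_eq]
  refine mul_le_mul_of_nonneg_left ?_ (by positivity)
  calc _ ≤ ∫ z : CSpace d, A * H (r • z + (1 - r) • q) :=
        integral_mono (FockSpace.integrable_sq (FockSpace.mk _ hmem)) (hi.const_mul _) hpt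
    _ ≤ _ := by
        rw [integral_const_mul]
        gcongr

/-! ### Weak limits of dilations -/

/-- A bounded net in the Fock space that converges pointwise converges weakly. -/
theorem FockSpace.tendsto_inner_of_tendsto_apply {d : ℕ} {ι : Type*} {l : Filter ι}
    {x : ι → FockSpace d} {y : FockSpace d} {M : ℝ} (hM : ∀ i, ‖x i‖ ≤ M)
    (hx : ∀ w, Filter.Tendsto (fun i => x i w) l (nhds (y w))) (g : FockSpace d) :
    Filter.Tendsto (fun i => inner ℂ g (x i)) l (nhds (inner ℂ g y)) := by
  have hspan : ∀ s ∈ Submodule.span ℂ (Set.range (kernel (d := d))),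
      Filter.Tendsto (fun i => inner ℂ s (x i)) l (nhds (inner ℂ s y)) := by
    intro s hs
    induction hs using Submodule.span_induction with
    | mem s hs =>
      obtain ⟨w, rfl⟩ := hs
      simpa only [inner_kernel] using hx w
    | zero => simpa only [inner_zero_left] using tendsto_const_nhds
    | add s t _ _ hs ht => simpa only [inner_add_left] using hs.add ht
    | smul c s _ hs => simpa only [inner_smul_left] using hs.const_mul _
  rw [Metric.tendsto_nhds]
  intro ε hε
  set B := |M| + ‖y‖ + 1
  have hB0 : 0 < B := by positivity
  -- Replacing `g` by a combination `s` of kernels costs at most `ε / 2`, uniformly in `i`, since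
  -- `B` bounds every `‖x i - y‖`.
  obtain ⟨s, hs, hgs⟩ := Metric.dense_iff.1 (dense_span_kernel d) g (ε / (2 * B)) (by positivity)
  have hgs' : ‖g - s‖ < ε / (2 * B) := by
    rw [← norm_sub_rev, ← dist_eq_norm]
    exact hs
  filter_upwards [Metric.tendsto_nhds.1 (hspan s hgs) (ε / 2) (by positivity)] with i hi
  rw [dist_eq_norm] at hi ⊢
  have h1 : inner ℂ g (x i) - inner ℂ g y =
      inner ℂ (g - s) (x i - y) + (inner ℂ s (x i) - inner ℂ s y) := by
    simp only [inner_sub_left, inner_sub_right]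
    ring
  have h2 : ‖x i - y‖ ≤ B := by
    have := norm_sub_le (x i) y
    have := hM i
    have := le_abs_self M
    linarith
  have h3 : ‖inner ℂ (g - s) (x i - y)‖ ≤ ε / 2 := by
    refine (norm_inner_le_norm _ _).trans ?_
    calc ‖g - s‖ * ‖x i - y‖ ≤ ε / (2 * B) * B := by gcongr
      _ = ε / 2 := by field_simp
  rw [h1]
  have := norm_add_le (inner ℂ (g - s) (x i - y)) (inner ℂ s (x i) - inner ℂ s y)
  linarith

theorem exists_seq_tendsto_one : ∃ r : ℕ → ℝ,
    (∀ n, 1 / 2 ≤ r n) ∧ (∀ n, r n < 1) ∧ Filter.Tendsto r Filter.atTop (nhds 1) := by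
  obtain ⟨r, _, hr, ht⟩ := exists_seq_strictMono_tendsto' (show (1 / 2 : ℝ) < 1 by norm_num)
  exact ⟨r, fun n => (hr n).1.le, fun n => (hr n).2, ht⟩

theorem tendsto_inner_dilate {d : ℕ} (p q : CSpace d) (g h : FockSpace d) {r : ℕ → ℝ}
    (hr : ∀ n, 1 / 2 ≤ r n) (hr1 : ∀ n, r n < 1)
    (ht : Filter.Tendsto r Filter.atTop (nhds 1))
    (hmem : ∀ n, dilate p q (r n : ℂ) h ∈ Fock.submodule d) :
    Filter.Tendsto (fun n => inner ℂ g (FockSpace.mk _ (hmem n))) Filter.atTop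
      (nhds (inner ℂ g h)) := by
  obtain ⟨C, hC⟩ := exists_norm_dilate_le p q h
  refine FockSpace.tendsto_inner_of_tendsto_apply
    (fun n => hC (r n) (hr n) (hr1 n) (hmem n)) (fun w => ?_) g
  have hh := h.differentiable.continuous
  have hc : Continuous fun s : ℝ => dilate p q (s : ℂ) h w := by
    simp only [dilate]
    fun_prop
  have h1 := (hc.tendsto 1).comp ht
  simpa [dilate, Function.comp_def] using h1

/-! ### Formal adjointness and equality -/

/-- The maximal operators with dual exponential weights and affine symbols are formal adjoints of
each other. -/
theorem inner_weightedComp {d : ℕ} (θ : ℂ) (Q : Matrix (Fin d) (Fin d) ℂ)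
    (p q : CSpace d) (f g u v : FockSpace d)
    (hu : (u : CSpace d → ℂ) = weightedComp (expWeight θ p) (affineMap Q q) f)
    (hv : (v : CSpace d → ℂ) = weightedComp (expWeight (starRingEnd ℂ θ) q)
      (affineMap Q.conjTranspose p) g) :
    inner ℂ g u = inner ℂ v f := by
  set L := LinearMap.toContinuousLinearMap (Matrix.toEuclideanLin Q)
  -- Dilating `u` with `p` gives the operator with data $\theta,p,rQ,q$ applied to `f`. Moving the
  -- dilation with `q` from `f` onto `v` gives the dual operator, with $(rQ)^*$, applied to `g`. The
  -- contractive adjoint formula for `r • Q` equates the two pairings.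
  have hsmall : ∀ (r : ℂ) (hr : ‖r‖ < 1), ‖r‖ * ‖L‖ < 1 →
      inner ℂ g (FockSpace.mk _ (dilate_mem p 0 hr u)) =
        inner ℂ v (FockSpace.mk _ (dilate_mem 0 q hr f)) := by
    intro r hr hrL
    have hcontr : ∀ z, ‖Matrix.toEuclideanLin (r • Q) z‖ ≤ ‖r‖ * ‖L‖ * ‖z‖ := by
      intro z
      rw [map_smul, LinearMap.smul_apply, norm_smul, mul_assoc]
      exact mul_le_mul_of_nonneg_left (L.le_opNorm z) (norm_nonneg r)
    have hV : weightedComp (expWeight (starRingEnd ℂ 1) ((1 - r) • q))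
        (affineMap (r • 1 : Matrix (Fin d) (Fin d) ℂ).conjTranspose 0) v ∈ Fock.submodule d := by
      rw [Matrix.conjTranspose_smul, Matrix.conjTranspose_one]
      obtain ⟨C, hC⟩ := exists_norm_weightedComp_le (starRingEnd ℂ 1) (star r • 1)
        ((1 - r) • q) 0 (norm_nonneg (star r)) (by simpa using hr)
        (norm_toEuclideanLin_smul_one (star r))
      exact (hC v).1
    rw [inner_weightedComp_of_contracting 1 (r • 1) ((1 - starRingEnd ℂ r) • 0) ((1 - r) • q)
      (norm_nonneg r) hr (norm_toEuclideanLin_smul_one r) f v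
      (FockSpace.mk _ (dilate_mem 0 q hr f)) (FockSpace.mk _ hV)
      (dilate_eq_weightedComp 0 q r f) (by rw [smul_zero]; rfl)]
    refine inner_weightedComp_of_contracting θ (r • Q) p q (by positivity) hrL hcontr f g _ _ ?_ ?_
    · funext z
      simp only [FockSpace.mk_apply, dilate, hu, weightedComp, expWeight, affineMap, smul_zero,
        add_zero, map_smul, LinearMap.smul_apply, cdot_smul_left]
      rw [mul_left_comm, ← mul_assoc, mul_assoc θ, ← Complex.exp_add]
      ring_nf
    · funext z
      simp only [FockSpace.mk_apply, hv, weightedComp, expWeight, affineMap,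
        Matrix.conjTranspose_smul, Matrix.conjTranspose_one, Matrix.toLpLin_one, map_smul,
        LinearMap.smul_apply, LinearMap.id_apply, add_zero, cdot_smul_left, cdot_smul_right,
        map_one, one_mul, map_sub]
      rw [mul_left_comm, ← mul_assoc, mul_assoc (starRingEnd ℂ θ),
        ← Complex.exp_add, ← starRingEnd_apply r]
      ring_nf
  -- The identity theorem carries the equality from a neighbourhood of 0 to the whole disc, however
  -- large `Q` is.
  have hdisc : Set.EqOn
      (fun r => 1 / (Real.pi : ℂ) ^ d * ∫ z : CSpace d,
        dilate p 0 r u z * starRingEnd ℂ (g z) * (Real.exp (-‖z‖ ^ 2) : ℂ))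
      (fun r => 1 / (Real.pi : ℂ) ^ d * ∫ z : CSpace d,
        dilate 0 q r f z * starRingEnd ℂ (v z) * (Real.exp (-‖z‖ ^ 2) : ℂ))
      (Metric.ball 0 1) := by
    refine AnalyticOnNhd.eqOn_of_preconnected_of_eventuallyEq
      (((differentiableOn_integral_dilate p 0 g u).const_mul _).analyticOnNhd Metric.isOpen_ball)
      (((differentiableOn_integral_dilate 0 q v f).const_mul _).analyticOnNhd Metric.isOpen_ball)
      (convex_ball (0 : ℂ) 1).isPreconnected (Metric.mem_ball_self one_pos) ?_
    have h1 : ∀ᶠ r : ℂ in nhds 0, ‖r‖ < 1 :=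
      continuous_norm.continuousAt.eventually_lt continuousAt_const (by simp)
    have h2 : ∀ᶠ r : ℂ in nhds 0, ‖r‖ * ‖L‖ < 1 :=
      (continuous_norm.mul_const ‖L‖).continuousAt.eventually_lt continuousAt_const (by simp)
    filter_upwards [h1, h2] with r hr hrL
    exact hsmall r hr hrL
  obtain ⟨r, hr, hr1, ht⟩ := exists_seq_tendsto_one
  have hrn : ∀ n, ‖(r n : ℂ)‖ < 1 := fun n => by
    rw [Complex.norm_real, Real.norm_of_nonneg (by linarith [hr n])]
    exact hr1 n
  -- At $r=1$ both dilations are the identity, so the weak limits are the two undilated pairings.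
  have hlim := tendsto_inner_dilate p 0 g u hr hr1 ht fun n => dilate_mem p 0 (hrn n) u
  have hlim' := tendsto_inner_dilate 0 q v f hr hr1 ht fun n => dilate_mem 0 q (hrn n) f
  refine tendsto_nhds_unique (hlim.congr fun n => ?_) hlim'
  exact hdisc (by simpa using hrn n)

theorem adjoint_expWeight_affineMap {d : ℕ} (θ : ℂ) (Q : Matrix (Fin d) (Fin d) ℂ)
    (p q : CSpace d) :
    (maxWeightedComp (expWeight θ p) (affineMap Q q)).adjoint =
      maxWeightedComp (expWeight (starRingEnd ℂ θ) q) (affineMap Q.conjTranspose p) := by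
  refine le_antisymm (adjoint_expWeight_affineMap_le θ Q p q) ?_
  refine LinearPMap.IsFormalAdjoint.le_adjoint (dense_domain_expWeight_affineMap θ Q p q) ?_
  refine LinearPMap.IsFormalAdjoint.symm fun g f => ?_
  exact (inner_weightedComp θ Q p q f g _ _ rfl rfl).symm

/-! ### Necessity: the kernel identity and its solutions -/

/-- The adjoint of a densely defined maximal weighted composition operator maps kernels to
multiples of kernels. -/
theorem adjoint_kernel {d : ℕ} {ψ : CSpace d → ℂ} {φ : CSpace d → CSpace d}
    (hT : Dense ((maxWeightedComp ψ φ).domain : Set (FockSpace d))) (z : CSpace d) :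
    ∃ h : FockSpace.kernel z ∈ (maxWeightedComp ψ φ).adjoint.domain,
      (maxWeightedComp ψ φ).adjoint ⟨_, h⟩ =
        (starRingEnd ℂ (ψ z)) • FockSpace.kernel (φ z) := by
  have key : ∀ f : (maxWeightedComp ψ φ).domain,
      inner ℂ ((starRingEnd ℂ (ψ z)) • FockSpace.kernel (φ z)) (f : FockSpace d) =
        inner ℂ (FockSpace.kernel z) (maxWeightedComp ψ φ f) := by
    intro f
    rw [inner_smul_left, FockSpace.inner_kernel, FockSpace.inner_kernel, Complex.conj_conj]
    rfl
  exact ⟨LinearPMap.mem_adjoint_domain_of_exists _ ⟨_, key⟩,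
    LinearPMap.adjoint_apply_eq hT _ key⟩

theorem kernel_identity_of_adjoint_le {d : ℕ} {ψ ξ : CSpace d → ℂ} {φ ϕ : CSpace d → CSpace d}
    (hT : Dense ((maxWeightedComp ψ φ).domain : Set (FockSpace d)))
    (hle : (maxWeightedComp ψ φ).adjoint ≤ maxWeightedComp ξ ϕ) (u z : CSpace d) :
    ξ u * Complex.exp (cdot (ϕ u) z) = starRingEnd ℂ (ψ z) * Complex.exp (cdot u (φ z)) := by
  obtain ⟨h, hz⟩ := adjoint_kernel hT z
  have h1 := hle.2 (x := ⟨_, h⟩) (y := ⟨_, hle.1 h⟩) rfl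
  rw [hz] at h1
  exact (congrArg (fun f : FockSpace d => f u) h1).symm

/-- An entire function vanishing at `0` whose exponential is constant vanishes. -/
theorem eq_zero_of_exp_eq_one {E : Type*} [NormedAddCommGroup E] [NormedSpace ℂ E] {c : E → ℂ}
    (hc : Differentiable ℂ c) (h0 : c 0 = 0) (h : ∀ u, Complex.exp (c u) = 1) (u : E) :
    c u = 0 := by
  rw [← h0]
  refine is_const_of_fderiv_eq_zero (𝕜 := ℂ) hc (fun x => ?_) u 0
  -- The derivative of $e^c$ is $e^c c'=c'$, and it vanishes because $e^c$ is constant.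
  have h1 := (hc x).hasFDerivAt.cexp
  simp only [h, one_smul] at h1
  exact h1.unique (hasFDerivAt_const 1 x)

theorem ext_cdot_left {d : ℕ} {x y : CSpace d} (h : ∀ u, cdot u x = cdot u y) : x = y :=
  ext_inner_right ℂ h

theorem ext_cdot_right {d : ℕ} {x y : CSpace d} (h : ∀ u, cdot x u = cdot y u) : x = y :=
  ext_inner_left ℂ h

/-- Nondegeneracy of the pairing forces `A` to be linear, with no regularity assumed, and `B` is
then its adjoint. -/
theorem exists_matrix_of_cdot_eq {d : ℕ} {A B : CSpace d → CSpace d}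
    (h : ∀ u z, cdot (B u) z = cdot u (A z)) :
    ∃ Q : Matrix (Fin d) (Fin d) ℂ,
      (∀ z, A z = Matrix.toEuclideanLin Q z) ∧
        ∀ u, B u = Matrix.toEuclideanLin Q.conjTranspose u := by
  let L : CSpace d →ₗ[ℂ] CSpace d :=
    { toFun := A
      map_add' := fun x y => ext_cdot_left fun u => by
        rw [cdot_add_right, ← h, ← h, ← h, cdot_add_right]
      map_smul' := fun c x => ext_cdot_left fun u => by
        rw [RingHom.id_apply, cdot_smul_right, ← h, ← h, cdot_smul_right] }
  have hL : ∀ z, A z = Matrix.toEuclideanLin (Matrix.toEuclideanLin.symm L) z := fun z => by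
    rw [LinearEquiv.apply_symm_apply]
    rfl
  refine ⟨Matrix.toEuclideanLin.symm L, hL, fun u => ext_cdot_right fun z => ?_⟩
  rw [h, hL, cdot_toEuclideanLin, Matrix.conjTranspose_conjTranspose]

theorem exists_expWeight_affineMap_of_kernel_identity {d : ℕ} {ψ ξ : CSpace d → ℂ}
    {φ ϕ : CSpace d → CSpace d} (hψ0 : ψ ≠ 0) (hϕ : Differentiable ℂ ϕ)
    (h : ∀ u z, ξ u * Complex.exp (cdot (ϕ u) z) =
      starRingEnd ℂ (ψ z) * Complex.exp (cdot u (φ z))) :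
    ∃ (θ : ℂ) (Q : Matrix (Fin d) (Fin d) ℂ) (p q : CSpace d),
      ψ = expWeight θ p ∧ φ = affineMap Q q ∧
      ξ = expWeight (starRingEnd ℂ θ) q ∧ ϕ = affineMap Q.conjTranspose p := by
  have hψ : ∀ z, ψ z = starRingEnd ℂ (ξ 0) * Complex.exp (cdot z (ϕ 0)) := fun z => by
    have h1 := congrArg (starRingEnd ℂ) (h 0 z)
    rw [map_mul, map_mul, ← Complex.exp_conj, conj_cdot] at h1
    simpa using h1.symm
  have hψz : ψ 0 = starRingEnd ℂ (ξ 0) := by simpa using hψ 0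
  have hξ : ∀ u, ξ u = ξ 0 * Complex.exp (cdot u (φ 0)) := fun u => by
    have h1 := h u 0
    rw [hψz] at h1
    simpa using h1
  have hξ0 : ξ 0 ≠ 0 := by
    intro h0
    refine hψ0 (funext fun z => ?_)
    simp [hψ, h0]
  have hAB : ∀ u z, cdot (ϕ u - ϕ 0) z = cdot u (φ z - φ 0) := by
    intro u z
    have hsub : ∀ x y w : CSpace d, cdot (x - y) w = cdot x w - cdot y w := fun x y w =>
      inner_sub_right _ _ _
    -- The argument runs in `u` with `z` fixed: the pairing is holomorphic only in its first slot,
    -- where `ϕ u` and `u` stand.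
    have hd : Differentiable ℂ fun u => cdot (ϕ u - ϕ 0) z - cdot u (φ z - φ 0) :=
      ((differentiable_cdot z).comp (hϕ.sub_const _)).sub (differentiable_cdot _)
    refine sub_eq_zero.1 (eq_zero_of_exp_eq_one hd (by simp) (fun u => ?_) u)
    have h1 := h u z
    rw [hξ u, hψ z, map_mul, Complex.conj_conj, ← Complex.exp_conj, conj_cdot, mul_assoc,
      mul_assoc, ← Complex.exp_add, ← Complex.exp_add] at h1
    have h2 := mul_left_cancel₀ hξ0 h1
    have h3 : cdot (ϕ u - ϕ 0) z - cdot u (φ z - φ 0) =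
        (cdot u (φ 0) + cdot (ϕ u) z) - (cdot (ϕ 0) z + cdot u (φ z)) := by
      have hr : cdot u (φ z - φ 0) = cdot u (φ z) - cdot u (φ 0) := inner_sub_left _ _ _
      rw [hsub, hr]
      ring
    rw [h3, Complex.exp_sub, h2, div_self (Complex.exp_ne_zero _)]
  obtain ⟨Q, hA, hB⟩ := exists_matrix_of_cdot_eq hAB
  refine ⟨starRingEnd ℂ (ξ 0), Q, ϕ 0, φ 0, funext hψ, funext fun z => ?_, funext fun u => ?_,
    funext fun u => ?_⟩
  · rw [affineMap, ← hA, sub_add_cancel]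
  · rw [Complex.conj_conj]
    exact hξ u
  · rw [affineMap, ← hB, sub_add_cancel]

theorem proposition2p3 (d : ℕ) (ψ ξ : CSpace d → ℂ) (φ ϕ : CSpace d → CSpace d)
    (hψ : Differentiable ℂ ψ) (hψ0 : ψ ≠ 0) (hξ : Differentiable ℂ ξ) (hξ0 : ξ ≠ 0)
    (hφ : Differentiable ℂ φ) (hϕ : Differentiable ℂ ϕ) :
    ((Dense ((maxWeightedComp ψ φ).domain : Set (FockSpace d)) ∧
        (maxWeightedComp ψ φ).adjoint ≤ maxWeightedComp ξ ϕ) ↔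
      ∃ (θ : ℂ) (Q : Matrix (Fin d) (Fin d) ℂ) (p q : CSpace d),
        ψ = expWeight θ p ∧ φ = affineMap Q q ∧
        ξ = expWeight (starRingEnd ℂ θ) q ∧ ϕ = affineMap Q.conjTranspose p) ∧
    (∀ (θ : ℂ) (Q : Matrix (Fin d) (Fin d) ℂ) (p q : CSpace d),
      ψ = expWeight θ p → φ = affineMap Q q →
      ξ = expWeight (starRingEnd ℂ θ) q → ϕ = affineMap Q.conjTranspose p →
      Q = Q.conjTranspose →
      (maxWeightedComp ψ φ).adjoint = maxWeightedComp ξ ϕ) := by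
  refine ⟨⟨fun ⟨hT, hle⟩ => ?_, ?_⟩, ?_⟩
  · exact exists_expWeight_affineMap_of_kernel_identity hψ0 hϕ
      (kernel_identity_of_adjoint_le hT hle)
  · rintro ⟨θ, Q, p, q, rfl, rfl, rfl, rfl⟩
    exact ⟨dense_domain_expWeight_affineMap θ Q p q, adjoint_expWeight_affineMap_le θ Q p q⟩
  · rintro θ Q p q rfl rfl rfl rfl -
    exact adjoint_expWeight_affineMap θ Q p q
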